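/- All graphs are simple and may be infinite. A graph is *infinitely edge-connected* if it has at least two vertices and deleting any finite set of edges leaves it connected. A $\Pi$-graph is an infinitely edge-connected graph that does not contain infinitely many independent paths between any two distinct vertices $u,v$, where $u$–$v$ paths are independent if any two of them have only $u$ and $v$ in common. A graph $H$ is a *minor* of a graph $G$ if there are pairwise disjoint sets $B_x\subseteq V(G)$ $(x\in V(H))$, each inducing a non-empty connected (possibly infinite) subgraph of $G$, such that $G$ has an edge between $B_x$ and $B_y$ whenever $xy$ is an edge of $H$. Two graphs are *minor-equivalent* if each is a minor of the other. A $\Pi$-graph is *typical* if it is a minor of every $\Pi$-graph. The *Farey graph* is the graph on $\mathbb{Q}\cup\{\infty\}$ in which $a/b$ and $c/d$, in lowest terms (with $\infty=(\pm1)/0$), are adjacent if and only if $\det\begin{pmatrix}a&c\\b&d\end{pmatrix}=\pm1$. **Theorem 1.** Up to minor-equivalence, the Farey graph is the unique typical $\Pi$-graph. That is, the Farey graph is a typical $\Pi$-graph, and every typical $\Pi$-graph is minor-equivalent to the Farey graph. -/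

import Mathlib

universe u v w

namespace SimpleGraph

/-- `H` is a minor of `G`: there is a family of pairwise disjoint (possibly infinite) branch sets in
`G`, indexed by the vertices of `H`, each of which induces a connected (in particular non-empty)
subgraph of `G`, such that `G` has an edge between any two branch sets whose indices are adjacent
in `H`. -/
def IsMinorOf {W : Type w} {V : Type v} (H : SimpleGraph W) (G : SimpleGraph V) : Prop :=
  ∃ B : W → Set V,
    (∀ x, (G.induce (B x)).Connected) ∧
    (∀ x y, x ≠ y → Disjoint (B x) (B y)) ∧
    (∀ x y, H.Adj x y → ∃ a ∈ B x, ∃ b ∈ B y, G.Adj a b)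

/-- Two graphs are minor-equivalent if they are minors of each other. -/
def MinorEquivalent {W : Type w} {V : Type v} (H : SimpleGraph W) (G : SimpleGraph V) : Prop :=
  H.IsMinorOf G ∧ G.IsMinorOf H

/-- A graph is infinitely edge-connected if it has more than one vertex and deleting finitely many
edges never disconnects it. -/
def IsInfinitelyEdgeConnected {V : Type v} (G : SimpleGraph V) : Prop :=
  Nontrivial V ∧ ∀ k : ℕ, G.IsEdgeConnected k

/-- Two paths between `a` and `b` are independent if they have no vertices in common other than
`a` and `b`. -/
def Path.Independent {V : Type v} {G : SimpleGraph V} {a b : V} (P Q : G.Path a b) : Prop :=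
  ∀ x, x ∈ P.1.support → x ∈ Q.1.support → x = a ∨ x = b

/-- `G` contains infinitely many (pairwise) independent paths between `a` and `b`. -/
def HasInfinitelyManyIndependentPaths {V : Type v} (G : SimpleGraph V) (a b : V) : Prop :=
  ∃ S : Set (G.Path a b), S.Infinite ∧ S.Pairwise Path.Independent

/-- A `Π`-graph is an infinitely edge-connected graph that does not contain infinitely many
independent paths between any two of its vertices. -/
def IsPiGraph {V : Type v} (G : SimpleGraph V) : Prop :=
  G.IsInfinitelyEdgeConnected ∧
    ∀ a b : V, a ≠ b → ¬ G.HasInfinitelyManyIndependentPaths a b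

/-- A typical `Π`-graph is a `Π`-graph that is a minor of every `Π`-graph. -/
def IsTypicalPiGraph {V : Type u} (G : SimpleGraph V) : Prop :=
  G.IsPiGraph ∧ ∀ (W : Type v) (H : SimpleGraph W), H.IsPiGraph → G.IsMinorOf H

end SimpleGraph

/-- The numerator of an element of `ℚ ∪ {∞}` in lowest terms, where `∞ = 1/0`. -/
def fareyNum : OnePoint ℚ → ℤ
  | none => 1
  | some q => q.num

/-- The denominator of an element of `ℚ ∪ {∞}` in lowest terms, where `∞ = 1/0`. -/
def fareyDen : OnePoint ℚ → ℤ
  | none => 0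
  | some q => (q.den : ℤ)

/-- The Farey graph: the graph on `ℚ ∪ {∞}` in which `a/b` and `c/d`, in lowest terms, are adjacent
if and only if `a * d - c * b = ±1`. -/
def fareyGraph : SimpleGraph (OnePoint ℚ) where
  Adj x y := |fareyNum x * fareyDen y - fareyNum y * fareyDen x| = 1
  symm := ⟨fun x y h => by rw [abs_sub_comm]; exact h⟩
  loopless := ⟨fun x h => by simp at h⟩

/-! Uniqueness is formal once two facts are known: the Farey graph is a Π-graph, and it is a minor
of every Π-graph `G`.

For the second fact, two vertices are linked through `U` if no finite edge set separates them there.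
A link can be split (`Link.exists_isSplit`): disjoint, adjacent connected sets `A` and `B` absorb
its ends, and two disjoint links lead from them to a common middle vertex. This rests on
`Linked.interpolate`: without infinitely many independent paths, finitely many vertices destroy the
link, and a shortest path in the graph of links between these vertices supplies the middle. Iterated
splitting follows the Stern–Brocot tree and yields the half of the Farey graph on [0, ∞]
(`Link.exists_branch_adj`); merging its ends 1/0 and 0/1 gives the whole graph.

For the first fact, rerouting an edge through mediants often enough escapes any finite set of edges.
Apart from the edge joining them, adjacent vertices are separated by their two common neighbours;
non-adjacent ones are separated by two consecutive neighbours of one of them. The side on which a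
vertex lies is the sign of a product of two determinants. -/

namespace SimpleGraph

/-! ### Walks confined to a vertex set -/

variable {V : Type v} {G : SimpleGraph V} {a b u v : V} {U R X Y T : Set V} {F F' : Set (Sym2 V)}

/-- The graph `G` with all vertices outside `X` isolated and the edges in `F` deleted. -/
def within (G : SimpleGraph V) (X : Set V) (F : Set (Sym2 V)) : SimpleGraph V where
  Adj x y := G.Adj x y ∧ s(x, y) ∉ F ∧ x ∈ X ∧ y ∈ X
  symm := ⟨fun x y h => ⟨h.1.symm, by rw [Sym2.eq_swap]; exact h.2.1, h.2.2.2, h.2.2.1⟩⟩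
  loopless := ⟨fun x h => G.loopless.irrefl x h.1⟩

theorem within_mono (hX : X ⊆ Y) (hF : F' ⊆ F) : G.within X F ≤ G.within Y F' :=
  fun _ _ h => ⟨h.1, fun h' => h.2.1 (hF h'), hX h.2.2.1, hX h.2.2.2⟩

theorem Reachable.within_mono {x y : V} (h : (G.within X F).Reachable x y) (hX : X ⊆ Y)
    (hF : F' ⊆ F) : (G.within Y F').Reachable x y :=
  h.mono (SimpleGraph.within_mono hX hF)

/-- Every walk that ends in `u` has an initial part that avoids `u` until the last step. -/
theorem Reachable.within_first_hit {y : V} (h : (G.within (insert u X) F).Reachable y u)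
    (hy : y ≠ u) :
    ∃ z, (G.within X F).Reachable y z ∧ (G.within (insert u X) F).Adj z u := by
  rw [reachable_iff_reflTransGen] at h
  induction h using Relation.ReflTransGen.head_induction_on with
  | refl => exact absurd rfl hy
  | @head y z hyz _ ih =>
    by_cases hz : z = u
    · subst hz
      exact ⟨y, Reachable.refl _, hyz⟩
    · obtain ⟨w, hw, hwu⟩ := ih hz
      have : (G.within X F).Adj y z :=
        ⟨hyz.1, hyz.2.1, hyz.2.2.1.resolve_left hy, hyz.2.2.2.resolve_left hz⟩
      exact ⟨w, this.reachable.trans hw, hwu⟩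

theorem Reachable.within_of_closed {Q : Set V} {y z : V} (h : (G.within X F).Reachable y z)
    (hQ : ∀ r ∈ Q, ∀ s, (G.within X F).Adj r s → s ∈ Q) (hy : y ∈ Q) :
    (G.within Q F).Reachable y z ∧ z ∈ Q := by
  rw [reachable_iff_reflTransGen] at h
  induction h with
  | refl => exact ⟨Reachable.refl _, hy⟩
  | tail _ hst ih =>
    have := hQ _ ih.2 _ hst
    exact ⟨ih.1.trans (Adj.reachable ⟨hst.1, hst.2.1, ih.2, this⟩), this⟩

theorem Reachable.mem_of_within {y z : V} (h : (G.within X F).Reachable y z) (hy : y ∈ X) :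
    z ∈ X :=
  (h.within_of_closed (Q := X) (fun _ _ _ h => h.2.2.2) hy).2

/-- The vertices reachable from a given one inside `X` induce a connected graph. -/
theorem Reachable.within_component {y z : V} (h : (G.within X F).Reachable y z) :
    (G.within {x | (G.within X F).Reachable y x} F).Reachable y z :=
  (h.within_of_closed (Q := {x | (G.within X F).Reachable y x})
    (fun _ hr _ h => Reachable.trans hr h.reachable) (Reachable.refl _)).1

theorem connected_induce_of_within {S : Set V} {c : V} (hc : c ∈ S)
    (h : ∀ x ∈ S, (G.within S F).Reachable c x) : (G.induce S).Connected := by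
  rw [connected_iff_exists_forall_reachable]
  refine ⟨⟨c, hc⟩, ?_⟩
  rintro ⟨x, hx⟩
  have h' := h x hx
  rw [reachable_iff_reflTransGen] at h'
  induction h' with
  | refl => exact Reachable.refl _
  | @tail y z _ hyz ih =>
    refine (ih hyz.2.2.1).trans (Adj.reachable ?_)
    exact hyz.1

/-! ### Links and their interpolation -/

/-- `a` and `b` cannot be separated by finitely many edges in the graph induced by `U` together
with `a` and `b`. -/
def Linked (G : SimpleGraph V) (a b : V) (U : Set V) : Prop :=
  ∀ F : Set (Sym2 V), F.Finite → (G.within (insert a (insert b U)) F).Reachable a b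

theorem Linked.symm (h : G.Linked a b U) : G.Linked b a U := fun F hF => by
  rw [Set.insert_comm]
  exact (h F hF).symm

theorem Linked.mono (h : G.Linked a b U) (hU : U ⊆ X) : G.Linked a b X := fun F hF =>
  (h F hF).within_mono (Set.insert_subset_insert (Set.insert_subset_insert hU)) le_rfl

/-- Uniting finite separators of the finitely many unlinked pairs makes mere reachability off a
single `F` certify a link. -/
theorem exists_finite_separating (hT : T.Finite) (R : Set V) :
    ∃ F : Set (Sym2 V), F.Finite ∧ ∀ u ∈ T, ∀ v ∈ T,
      (G.within (insert u (insert v R)) F).Reachable u v → G.Linked u v R := by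
  have : ∀ u v : V, ∃ F : Set (Sym2 V), F.Finite ∧
      ((G.within (insert u (insert v R)) F).Reachable u v → G.Linked u v R) := by
    intro u v
    by_cases h : G.Linked u v R
    · exact ⟨∅, Set.finite_empty, fun _ => h⟩
    · have h' := h
      simp only [Linked, not_forall] at h
      obtain ⟨F, hF, hF'⟩ := h
      exact ⟨F, hF, fun h => absurd h hF'⟩
  choose F hF h using this
  refine ⟨⋃ u ∈ T, ⋃ v ∈ T, F u v, hT.biUnion fun u _ => hT.biUnion fun v _ => hF u v, ?_⟩
  intro u hu v hv huv
  refine h u v (huv.within_mono le_rfl ?_)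
  intro e he
  simp only [Set.mem_iUnion]
  exact ⟨u, hu, v, hv, he⟩

/-- The graph on `T` in which two vertices are adjacent if they are linked through `R`. -/
def linkGraph (G : SimpleGraph V) (T R : Set V) : SimpleGraph V where
  Adj u v := u ≠ v ∧ u ∈ T ∧ v ∈ T ∧ G.Linked u v R
  symm := ⟨fun _ _ h => ⟨h.1.symm, h.2.2.1, h.2.1, h.2.2.2.symm⟩⟩
  loopless := ⟨fun _ h => h.1 rfl⟩

/-- A walk from `a` to `b` off the separator of `exists_finite_separating` is cut at its visits to
`T`; each piece runs through `U \ T` and so certifies a link. -/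
theorem Linked.reachable_linkGraph (h : G.Linked a b U) (hT : T.Finite) (ha : a ∈ T) (hb : b ∈ T) :
    (G.linkGraph T (U \ T)).Reachable a b := by
  obtain ⟨F, hF, hsep⟩ := exists_finite_separating (G := G) hT (U \ T)
  have key : ∀ y, (G.within (insert a (insert b U)) F).Reachable a y →
      (y ∈ T → (G.linkGraph T (U \ T)).Reachable a y) ∧
      (y ∉ T → ∃ u ∈ T, (G.linkGraph T (U \ T)).Reachable a u ∧
        (G.within (insert u (U \ T)) F).Reachable u y) := by
    have link : ∀ u ∈ T, ∀ v ∈ T, (G.linkGraph T (U \ T)).Reachable a u →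
        (G.within (insert u (insert v (U \ T))) F).Reachable u v →
        (G.linkGraph T (U \ T)).Reachable a v := by
      intro u hu v hv hau huv
      by_cases e : u = v
      · exact e ▸ hau
      · exact hau.trans (Adj.reachable ⟨e, hu, hv, hsep u hu v hv huv⟩)
    have memU : ∀ y ∈ (insert a (insert b U) : Set V), y ∉ T → y ∈ U \ T := by
      rintro y (rfl | rfl | hy) hyT
      · exact absurd ha hyT
      · exact absurd hb hyT
      · exact ⟨hy, hyT⟩
    intro y hy
    rw [reachable_iff_reflTransGen] at hy
    induction hy with
    | refl => exact ⟨fun _ => Reachable.refl _, fun h => absurd ha h⟩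
    | @tail y z _ hyz ih =>
      by_cases hyT : y ∈ T
      · have hay := ih.1 hyT
        refine ⟨fun hzT => link y hyT z hzT hay (Adj.reachable ⟨hyz.1, hyz.2.1, by simp, by simp⟩),
          fun hzT => ⟨y, hyT, hay, Adj.reachable ⟨hyz.1, hyz.2.1, by simp, ?_⟩⟩⟩
        exact Or.inr (memU z hyz.2.2.2 hzT)
      · obtain ⟨u, huT, hau, huy⟩ := ih.2 hyT
        have hyU := memU y hyz.2.2.1 hyT
        refine ⟨fun hzT => link u huT z hzT hau ?_, fun hzT => ⟨u, huT, hau, ?_⟩⟩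
        · refine (huy.within_mono ?_ le_rfl).trans
            (Adj.reachable ⟨hyz.1, hyz.2.1, Or.inr (Or.inr hyU), Or.inr (Or.inl rfl)⟩)
          exact Set.insert_subset_insert (Set.subset_insert _ _)
        · exact huy.trans
            (Adj.reachable ⟨hyz.1, hyz.2.1, Or.inr hyU, Or.inr (memU z hyz.2.2.2 hzT)⟩)
  exact (key b (h F hF)).1 hb

/-- The vertices of `R` that are reachable from both `u` and `v` through `R` without using `F`. -/
def commonRegion (G : SimpleGraph V) (R : Set V) (F : Set (Sym2 V)) (u v : V) : Set V :=
  {r | r ∈ R ∧ (G.within (insert u R) F).Reachable u r ∧ (G.within (insert v R) F).Reachable v r}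

/-- A walk off `F' ∪ F`, trimmed to run from a last visit of `u` to a first visit of `v`, has its
interior in the common region. Links are thus confined to sets whose overlaps can be controlled. -/
theorem Linked.commonRegion (h : G.Linked u v R) (huv : u ≠ v) (hF : F.Finite) :
    G.Linked u v (G.commonRegion R F u v) := by
  intro F' hF'
  set Q := G.commonRegion R F u v
  have h1 := h (F' ∪ F) (hF'.union hF)
  rw [Set.insert_comm] at h1
  obtain ⟨y, huy, hyv⟩ := h1.within_first_hit huv
  by_cases hyu : y = u
  · subst hyu
    exact Adj.reachable ⟨hyv.1, fun h => hyv.2.1 (Or.inl h), by simp, by simp⟩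
  have hyR : y ∈ R := (huy.mem_of_within (by simp)).resolve_left hyu
  obtain ⟨z, hyz, hzu⟩ := huy.symm.within_first_hit hyu
  have hyQ : y ∈ Q := by
    refine ⟨hyR, huy.within_mono le_rfl Set.subset_union_right, Reachable.symm (Adj.reachable
      ⟨hyv.1, fun h => hyv.2.1 (Or.inr h), Or.inr hyR, Or.inl rfl⟩)⟩
  have hyz' := hyz.within_of_closed (Q := Q) (by
    rintro r ⟨-, hr1, hr2⟩ s hrs
    exact ⟨hrs.2.2.2,
      hr1.trans (Adj.reachable ⟨hrs.1, fun h => hrs.2.1 (Or.inr h), Or.inr hrs.2.2.1,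
        Or.inr hrs.2.2.2⟩),
      hr2.trans (Adj.reachable ⟨hrs.1, fun h => hrs.2.1 (Or.inr h), Or.inr hrs.2.2.1,
        Or.inr hrs.2.2.2⟩)⟩) hyQ
  have e1 : (G.within (insert u (insert v Q)) F').Adj u z :=
    ⟨hzu.1.symm, fun h => hzu.2.1 (Or.inl (by rw [Sym2.eq_swap]; exact h)), by simp,
      Or.inr (Or.inr hyz'.2)⟩
  have e2 : (G.within (insert u (insert v Q)) F').Adj y v :=
    ⟨hyv.1, fun h => hyv.2.1 (Or.inl h), Or.inr (Or.inr hyQ), by simp⟩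
  refine e1.reachable.trans (Reachable.trans ?_ e2.reachable)
  exact hyz'.1.symm.within_mono ((Set.subset_insert _ _).trans (Set.subset_insert _ _))
    Set.subset_union_left

theorem linked_of_mem_regions {r : V}
    (hsep : ∀ u ∈ T, ∀ v ∈ T, (G.within (insert u (insert v R)) F).Reachable u v → G.Linked u v R)
    (hu : u ∈ T) (hv : v ∈ T) (hur : (G.within (insert u R) F).Reachable u r)
    (hvr : (G.within (insert v R) F).Reachable v r) : G.Linked u v R :=
  hsep u hu v hv ((hur.within_mono (Set.insert_subset_insert (Set.subset_insert _ _)) le_rfl).trans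
    (hvr.within_mono (Set.subset_insert _ _) le_rfl).symm)

/-- If there are not infinitely many independent paths between `a` and `b`, then deleting finitely
many vertices of `U` leaves `a` and `b` unlinked. -/
theorem exists_finite_not_linked (hab : a ≠ b) (h : ¬ G.HasInfinitelyManyIndependentPaths a b)
    (U : Set V) : ∃ S : Set V, S.Finite ∧ S ⊆ U ∧ ¬ G.Linked a b (U \ S) := by
  classical
  by_contra! hcon
  apply h
  have hcon' : ∀ S : Set V, S.Finite → G.Linked a b (U \ S) := fun S hS =>
    (hcon (S ∩ U) (hS.inter_of_left _) Set.inter_subset_right).mono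
      (fun x hx => ⟨hx.1, fun h => hx.2 ⟨h, hx.1⟩⟩)
  obtain ⟨f, hf, hf'⟩ := exists_seq_of_forall_finset_exists
    (fun P : G.Path a b => ∃ x ∈ P.1.support, x ≠ a ∧ x ≠ b) (fun P Q => Path.Independent P Q) (by
      intro s _
      have hfin : (⋃ P ∈ s, {x | x ∈ P.1.support} : Set V).Finite :=
        s.finite_toSet.biUnion fun P _ => P.1.support.finite_toSet
      -- Deleting the edge `ab` forces an interior vertex on the new path, so that independent paths
      -- are distinct.
      have hlink := hcon' _ hfin {s(a, b)} (Set.finite_singleton _)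
      set W : Set V := insert a (insert b (U \ ⋃ P ∈ s, {x | x ∈ P.1.support}))
      obtain ⟨w, hw⟩ := hlink.exists_isPath
      have hsupp : ∀ x ∈ w.support, x ∈ W := by
        intro x hx
        have : (G.within W {s(a, b)}).Reachable a x := ⟨w.takeUntil x hx⟩
        exact this.mem_of_within (by simp [W])
      have hle : G.within W {s(a, b)} ≤ G := fun _ _ h => h.1
      refine ⟨⟨w.mapLe hle, hw.mapLe hle⟩, ?_, ?_⟩
      · cases w with
        | nil => exact absurd rfl hab
        | @cons _ c _ hac p =>
          refine ⟨c, by simp, hac.1.ne', ?_⟩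
          rintro rfl
          exact hac.2.1 rfl
      · intro P hP x hxP hx
        simp only [Walk.support_mapLe_eq_support] at hx
        rcases hsupp x hx with rfl | rfl | hx'
        · exact Or.inl rfl
        · exact Or.inr rfl
        · exact absurd (Set.mem_biUnion hP hxP) hx'.2)
  have hne : ∀ m n, m < n → f m ≠ f n := by
    intro m n hmn e
    obtain ⟨x, hx, hxa, hxb⟩ := hf m
    rcases hf' m n hmn x hx (e ▸ hx) with h | h
    · exact hxa h
    · exact hxb h
  have hinj : Function.Injective f := fun m n e => by
    rcases lt_trichotomy m n with h | h | h
    · exact absurd e (hne _ _ h)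
    · exact h
    · exact absurd e.symm (hne _ _ h)
  refine ⟨Set.range f, Set.infinite_range_of_injective hinj, ?_⟩
  rintro _ ⟨m, rfl⟩ _ ⟨n, rfl⟩ hmn
  rcases lt_trichotomy m n with h | h | h
  · exact hf' m n h
  · exact absurd (congrArg f h) hmn
  · intro x hx hy
    exact hf' n m h x hy hx

/-- Linked vertices `a` and `b` without infinitely many independent paths between them can be
interpolated by a vertex `z`, so that the two new links use disjoint parts of `U`. -/
theorem Linked.interpolate (hlink : G.Linked a b U) (hab : a ≠ b) (ha : a ∉ U) (hb : b ∉ U)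
    (h : ¬ G.HasInfinitelyManyIndependentPaths a b) :
    ∃ (z c : V) (U₁ U₂ B : Set V), z ∈ U ∧ b ∈ B ∧ c ∈ B ∧ B ⊆ insert b U ∧
      (∀ x ∈ B, (G.within B ∅).Reachable b x) ∧ U₁ ⊆ U ∧ U₂ ⊆ U ∧ z ∉ U₁ ∧ z ∉ U₂ ∧ z ∉ B ∧
      Disjoint U₁ U₂ ∧ Disjoint B U₁ ∧ Disjoint B U₂ ∧ G.Linked a z U₁ ∧ G.Linked z c U₂ := by
  obtain ⟨S, hS, hSU, hnot⟩ := exists_finite_not_linked hab h U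
  set T : Set V := insert a (insert b S) with hT
  have hTfin : T.Finite := (hS.insert b).insert a
  set R := U \ T with hR
  have haT : a ∈ T := by simp [hT]
  have hbT : b ∈ T := by simp [hT]
  have hnot' : ¬ G.Linked a b R := fun h =>
    hnot (h.mono fun x hx => ⟨hx.1, fun h => hx.2 (by simp [hT, h])⟩)
  set K := G.linkGraph T R with hK
  obtain ⟨F, hF, hsep⟩ := exists_finite_separating (G := G) hTfin R
  have hadj : ∀ {u v r : V}, u ∈ T → v ∈ T → (G.within (insert u R) F).Reachable u r →
      (G.within (insert v R) F).Reachable v r → u = v ∨ K.Adj u v := by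
    intro u v r hu hv hur hvr
    by_cases e : u = v
    · exact Or.inl e
    · exact Or.inr ⟨e, hu, hv, linked_of_mem_regions hsep hu hv hur hvr⟩
  -- On a shortest path `a, s, c, …, b` of `K`, the vertex `s` becomes the middle. Regions of
  -- different links on it can be kept apart because an overlap would create a shortcut.
  obtain ⟨p, hp⟩ := (hlink.reachable_linkGraph hTfin haT hbT).exists_walk_length_eq_dist
  have hdist : ∀ {u : V} (q : K.Walk u b) (n : ℕ), (q.length + n < K.dist a b) →
      ∀ q' : K.Walk a u, ¬ q'.length ≤ n := by
    intro u q n hq q' hq'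
    have := K.dist_le (q'.append q)
    rw [Walk.length_append] at this
    omega
  obtain ⟨s, h1, p₁, rfl⟩ := Walk.exists_eq_cons_of_ne hab p
  have hsb : s ≠ b := by
    rintro rfl
    exact hnot' h1.2.2.2
  obtain ⟨c, h2, q, rfl⟩ := Walk.exists_eq_cons_of_ne hsb p₁
  simp only [Walk.length_cons] at hp
  change q.length + 1 + 1 = K.dist a b at hp
  set U₁ := G.commonRegion R F a s with hU₁
  set U₂ := G.commonRegion R F s c with hU₂
  set Y : Set V := (insert b U \ insert s (U₁ ∪ U₂)) with hY
  have hsa : s ≠ a := h1.1.symm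
  have hU₁R : U₁ ⊆ R := fun r hr => hr.1
  have hU₂R : U₂ ⊆ R := fun r hr => hr.1
  have hTU : ∀ x ∈ T, x ≠ a → x ∈ insert b U := by
    rintro x (rfl | rfl | hx) hxa
    · exact absurd rfl hxa
    · simp
    · exact Or.inr (hSU hx)
  have hYT : ∀ x ∈ T, x ≠ a → x ≠ s → x ∈ Y := by
    intro x hx hxa hxs
    refine ⟨hTU x hx hxa, ?_⟩
    rintro (h | h | h)
    · exact hxs h
    · exact (hU₁R h).2 hx
    · exact (hU₂R h).2 hx
  have hbY : b ∈ Y := hYT b hbT hab.symm hsb.symm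
  -- The tail of the path from `c` to `b` can be followed inside `Y`, so `c` lies in the component
  -- of `b`.
  have chain : ∀ (n : ℕ) (x : V) (q' : K.Walk x b), q'.length = n → q'.length + 2 ≤ K.dist a b →
      x ∈ Y ∧ (G.within Y ∅).Reachable x b := by
    intro n
    induction n with
    | zero =>
      intro x q' h0 _
      obtain rfl := Walk.eq_of_length_eq_zero h0
      exact ⟨hbY, Reachable.refl _⟩
    | succ n ih =>
      intro x q' hn hlen
      by_cases hxb : x = b
      · subst hxb
        exact ⟨hbY, Reachable.refl _⟩
      obtain ⟨y, hxy, q'', rfl⟩ := Walk.exists_eq_cons_of_ne hxb q'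
      rw [Walk.length_cons] at hlen
      have hya := hdist q'' 2 (by omega)
      have hxa := hdist (.cons hxy q'') 1 (by rw [Walk.length_cons]; omega)
      have hxY : x ∈ Y := by
        refine hYT x hxy.2.1 ?_ ?_
        · rintro rfl
          exact hxa .nil (by simp)
        · rintro rfl
          exact hxa (.cons h1 .nil) (by simp)
      obtain ⟨hyY, hy⟩ := ih y q'' (by rw [Walk.length_cons] at hn; omega) (by omega)
      refine ⟨hxY, Reachable.trans ?_ hy⟩
      refine (hxy.2.2.2.commonRegion hxy.1 hF ∅ Set.finite_empty).within_mono ?_ le_rfl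
      -- An overlap is charged to the end `y` nearer to `b`: for `x = c`, meeting `U₂` would give no
      -- shortcut from `x`.
      rintro r (rfl | rfl | ⟨hrR, -, hyr⟩)
      · exact hxY
      · exact hyY
      · refine ⟨Or.inr hrR.1, ?_⟩
        rintro (rfl | hr | hr)
        · exact hrR.2 h1.2.2.1
        · rcases hadj haT hxy.2.2.1 hr.2.1 hyr with e | e
          · subst e
            exact hya .nil (by simp)
          · exact hya (.cons e .nil) (by simp)
        · rcases hadj h1.2.2.1 hxy.2.2.1 hr.2.1 hyr with e | e
          · subst e
            exact hya (.cons h1 .nil) (by simp)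
          · exact hya (.cons h1 (.cons e .nil)) (by simp)
  obtain ⟨hcY, hcb⟩ := chain _ c q rfl (by omega)
  have hBY : {x | (G.within Y ∅).Reachable b x} ⊆ Y := fun x hx => hx.mem_of_within hbY
  refine ⟨s, c, U₁, U₂, {x | (G.within Y ∅).Reachable b x}, ?_, Reachable.refl _, hcb.symm,
    fun x hx => (hBY hx).1, fun x hx => hx.within_component, hU₁R.trans Set.sdiff_subset,
    hU₂R.trans Set.sdiff_subset, fun h => (hU₁R h).2 h1.2.2.1, fun h => (hU₂R h).2 h1.2.2.1,
    fun h => (hBY h).2 (by simp), ?_, ?_, ?_, h1.2.2.2.commonRegion h1.1 hF,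
    h2.2.2.2.commonRegion h2.1 hF⟩
  · exact (hTU s h1.2.2.1 hsa).resolve_left hsb
  · rw [Set.disjoint_left]
    intro r hr hr'
    have hac := hdist q 1 (by omega)
    rcases hadj haT h2.2.2.1 hr.2.1 hr'.2.2 with e | e
    · subst e
      exact hac .nil (by simp)
    · exact hac (.cons e .nil) (by simp)
  · rw [Set.disjoint_left]
    exact fun x hx hx' => (hBY hx).2 (by simp [hx'])
  · rw [Set.disjoint_left]
    exact fun x hx hx' => (hBY hx).2 (by simp [hx'])

/-! ### Splitting a link -/

/-- Two distinct vertices that are linked through a set containing neither of them. -/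
structure Link (G : SimpleGraph V) where
  a : V
  b : V
  U : Set V
  ne : a ≠ b
  ha : a ∉ U
  hb : b ∉ U
  linked : G.Linked a b U

/-- `A` and `B` are adjacent connected sets, containing the two ends of the link `σ`, and `l` and
`r` are disjoint links from `A` and from `B` to a common vertex. -/
structure Link.IsSplit (σ : G.Link) (A B : Set V) (l r : G.Link) : Prop where
  a_mem : σ.a ∈ A
  b_mem : σ.b ∈ B
  A_subset : A ⊆ insert σ.a σ.U
  B_subset : B ⊆ insert σ.b σ.U
  A_conn : ∀ x ∈ A, (G.within A ∅).Reachable σ.a x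
  B_conn : ∀ x ∈ B, (G.within B ∅).Reachable σ.b x
  adj : ∃ x ∈ A, ∃ y ∈ B, G.Adj x y
  la_mem : l.a ∈ A
  rb_mem : r.b ∈ B
  mid : l.b = r.a
  mid_mem : l.b ∈ σ.U
  l_subset : l.U ⊆ σ.U
  r_subset : r.U ⊆ σ.U
  disj_AB : Disjoint A B
  disj_Al : Disjoint A l.U
  disj_Ar : Disjoint A r.U
  disj_Bl : Disjoint B l.U
  disj_Br : Disjoint B r.U
  disj_lr : Disjoint l.U r.U
  mid_A : l.b ∉ A
  mid_B : l.b ∉ B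

/-- `A` is the vertex set of a walk from `a` through `U` to a neighbour of `b`. As `A` is finite,
the link graph on `A ∪ {b}` is available; the last edge of a path to `b` in it is a link from some
`a₁ ∈ A` that avoids `A`, and this link is interpolated. -/
theorem Link.exists_isSplit (h : ∀ a b : V, a ≠ b → ¬ G.HasInfinitelyManyIndependentPaths a b)
    (σ : G.Link) : ∃ (A B : Set V) (l r : G.Link), σ.IsSplit A B l r := by
  obtain ⟨a, b, U, ne, ha, hb, linked⟩ := σ
  have hlink := linked ∅ Set.finite_empty
  rw [Set.insert_comm] at hlink
  obtain ⟨y, hay, hyb⟩ := hlink.within_first_hit ne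
  obtain ⟨w⟩ := hay
  set A : Set V := {x | x ∈ w.support} with hA
  have hAfin : A.Finite := w.support.finite_toSet
  have hAsub : A ⊆ insert a U := by
    classical
    intro x hx
    have : (G.within (insert a U) ∅).Reachable a x := ⟨w.takeUntil x hx⟩
    exact this.mem_of_within (by simp)
  have haA : a ∈ A := w.start_mem_support
  have hAconn : ∀ x ∈ A, (G.within A ∅).Reachable a x := by
    have : ∀ {u v : V} (w : (G.within (insert a U) ∅).Walk u v), ∀ x ∈ w.support,
        (G.within {x | x ∈ w.support} ∅).Reachable u x := by
      intro u v w
      induction w with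
      | nil =>
        intro x hx
        simp only [Walk.support_nil, List.mem_singleton] at hx
        exact hx ▸ Reachable.refl _
      | @cons u c v huc p ih =>
        intro x hx
        rw [Walk.support_cons, List.mem_cons] at hx
        rcases hx with rfl | hx
        · exact Reachable.refl _
        · refine Reachable.trans (Adj.reachable ⟨huc.1, by simp, by simp, by simp⟩)
            ((ih x hx).within_mono ?_ le_rfl)
          intro z hz
          simp only [Set.mem_ofPred_eq, Walk.support_cons, List.mem_cons] at hz ⊢
          exact Or.inr hz
    exact this w
  have hbA : b ∉ A := fun h => (hAsub h).elim (fun e => ne e.symm) hb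
  set T := insert b A with hT
  have hred := linked.reachable_linkGraph (hAfin.insert b) (a := a) (b := b)
    (Or.inr haA) (Or.inl rfl)
  obtain ⟨a₁, ha₁A, ha₁⟩ : ∃ a₁ ∈ A, G.Linked a₁ b (U \ T) := by
    rw [reachable_iff_reflTransGen] at hred
    rcases Relation.ReflTransGen.cases_tail hred with e | ⟨a₁, -, h1⟩
    · exact absurd e.symm ne
    · exact ⟨a₁, h1.2.1.resolve_left h1.1, h1.2.2.2⟩
  have hne : a₁ ≠ b := fun e => hbA (e ▸ ha₁A)
  have hsubU : U \ T ⊆ U := Set.sdiff_subset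
  obtain ⟨z, c, U₁, U₂, B, hz, hbB, hcB, hB, hBconn, hU₁, hU₂, hz1, hz2, hzB, h12, hB1, hB2, l1,
    l2⟩ := ha₁.interpolate hne (fun h => h.2 (Or.inr ha₁A)) (fun h => hb h.1) (h _ _ hne)
  have hA' : ∀ x ∈ U \ T, x ∉ A := fun x hx hxA => hx.2 (Or.inr hxA)
  refine ⟨A, B, ⟨a₁, z, U₁, fun e => hA' z hz (e ▸ ha₁A), fun h => hA' _ (hU₁ h) ha₁A, hz1, l1⟩,
    ⟨z, c, U₂, fun e => hzB (e ▸ hcB), hz2, fun h => Set.disjoint_left.1 hB2 hcB h, l2⟩, ?_⟩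
  exact
    { a_mem := haA
      b_mem := hbB
      A_subset := hAsub
      B_subset := hB.trans (Set.insert_subset_insert hsubU)
      A_conn := hAconn
      B_conn := hBconn
      adj := ⟨y, w.end_mem_support, b, hbB, hyb.1⟩
      la_mem := ha₁A
      rb_mem := hcB
      mid := rfl
      mid_mem := hsubU hz
      l_subset := hU₁.trans hsubU
      r_subset := hU₂.trans hsubU
      disj_AB := Set.disjoint_left.2 fun x hx hx' =>
        (hB hx').elim (fun e => hbA (e ▸ hx)) fun h => hA' x h hx
      disj_Al := Set.disjoint_left.2 fun x hx hx' => hA' x (hU₁ hx') hx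
      disj_Ar := Set.disjoint_left.2 fun x hx hx' => hA' x (hU₂ hx') hx
      disj_Bl := hB1
      disj_Br := hB2
      disj_lr := h12
      mid_A := hA' z hz
      mid_B := hzB }

/-! ### Branch sets from iterated splitting -/

/-- Membership in the branch sets of the half of the Farey graph that is obtained from the link `σ`
by repeated splitting: the vertex `p / q` of the Farey graph corresponds to `(p, q)`. -/
inductive Link.Branch (A B : G.Link → Set V) (l r : G.Link → G.Link) : G.Link → ℕ → ℕ → V → Prop
  | left_end {σ : G.Link} {x : V} (h : x ∈ A σ) : Branch A B l r σ 1 0 x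
  | right_end {σ : G.Link} {x : V} (h : x ∈ B σ) : Branch A B l r σ 0 1 x
  | left {σ : G.Link} {p q : ℕ} {x : V} (h : Branch A B l r (l σ) p q x) :
      Branch A B l r σ (p + q) q x
  | right {σ : G.Link} {p q : ℕ} {x : V} (h : Branch A B l r (r σ) p q x) :
      Branch A B l r σ p (p + q) x

namespace Link

variable {A B : G.Link → Set V} {l r : G.Link → G.Link} {σ : G.Link}

/-- This confinement is what turns the disjointness of `A`, `B`, `(l σ).U` and `(r σ).U` into
disjointness of branch sets. -/
theorem Branch.mem_or {p q : ℕ} {x : V} (hs : ∀ σ : G.Link, σ.IsSplit (A σ) (B σ) (l σ) (r σ))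
    (h : Branch A B l r σ p q x) :
    x ∈ σ.U ∨ (x = σ.a ∧ p = 1 ∧ q = 0) ∨ (x = σ.b ∧ p = 0 ∧ q = 1) := by
  induction h with
  | @left_end σ x h => rcases (hs σ).A_subset h with h | h <;> simp [h]
  | @right_end σ x h => rcases (hs σ).B_subset h with h | h <;> simp [h]
  | @left σ p q x h ih =>
    rcases ih with h | ⟨rfl, rfl, rfl⟩ | ⟨rfl, rfl, rfl⟩
    · exact Or.inl ((hs σ).l_subset h)
    · rcases (hs σ).A_subset (hs σ).la_mem with h | h <;> simp [h]
    · exact Or.inl (hs σ).mid_mem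
  | @right σ p q x h ih =>
    rcases ih with h | ⟨rfl, rfl, rfl⟩ | ⟨rfl, rfl, rfl⟩
    · exact Or.inl ((hs σ).r_subset h)
    · exact Or.inl ((hs σ).mid ▸ (hs σ).mid_mem)
    · rcases (hs σ).B_subset (hs σ).rb_mem with h | h <;> simp [h]

/-- The two halves meet only in the middle vertex, which is 0/1 on the left and 1/0 on the right;
both become the mediant 1/1. -/
theorem Branch.left_right {p q p' q' : ℕ} {x : V}
    (hs : ∀ σ : G.Link, σ.IsSplit (A σ) (B σ) (l σ) (r σ))
    (h : Branch A B l r (l σ) p q x) (h' : Branch A B l r (r σ) p' q' x) :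
    p + q = p' ∧ q = p' + q' := by
  have H := hs σ
  have e1 : x ∈ (l σ).U → x ∉ (r σ).U := fun h => Set.disjoint_left.1 H.disj_lr h
  have e2 := Set.disjoint_left.1 H.disj_Bl H.rb_mem
  have e3 := Set.disjoint_left.1 H.disj_Ar H.la_mem
  have e4 := (l σ).hb
  have e5 := (r σ).ha
  have e6 := H.mid
  have e7 := H.mid_A
  have e8 := H.mid_B
  have e9 := H.la_mem
  have e10 := H.rb_mem
  have e11 := Set.disjoint_left.1 H.disj_AB H.la_mem
  rcases h.mem_or hs with e | ⟨e, rfl, rfl⟩ | ⟨e, rfl, rfl⟩ <;>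
    rcases h'.mem_or hs with e' | ⟨e', rfl, rfl⟩ | ⟨e', rfl, rfl⟩ <;> grind

theorem Branch.of_mem_A {p q : ℕ} {x : V} (hs : ∀ σ : G.Link, σ.IsSplit (A σ) (B σ) (l σ) (r σ))
    (h : Branch A B l r σ p q x) (hx : x ∈ A σ) : p = 1 ∧ q = 0 := by
  have H := hs σ
  cases h with
  | left_end h => simp
  | right_end h => exact absurd h (Set.disjoint_left.1 H.disj_AB hx)
  | left h =>
    rcases h.mem_or hs with e | ⟨e, rfl, rfl⟩ | ⟨e, rfl, rfl⟩
    · exact absurd e (Set.disjoint_left.1 H.disj_Al hx)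
    · simp
    · exact absurd (e ▸ hx) H.mid_A
  | right h =>
    rcases h.mem_or hs with e | ⟨e, rfl, rfl⟩ | ⟨e, rfl, rfl⟩
    · exact absurd e (Set.disjoint_left.1 H.disj_Ar hx)
    · exact absurd (H.mid ▸ e ▸ hx) H.mid_A
    · exact absurd H.rb_mem (Set.disjoint_left.1 H.disj_AB (e ▸ hx))

theorem Branch.of_mem_B {p q : ℕ} {x : V} (hs : ∀ σ : G.Link, σ.IsSplit (A σ) (B σ) (l σ) (r σ))
    (h : Branch A B l r σ p q x) (hx : x ∈ B σ) : p = 0 ∧ q = 1 := by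
  have H := hs σ
  cases h with
  | left_end h => exact absurd hx (Set.disjoint_left.1 H.disj_AB h)
  | right_end h => simp
  | left h =>
    rcases h.mem_or hs with e | ⟨e, rfl, rfl⟩ | ⟨e, rfl, rfl⟩
    · exact absurd e (Set.disjoint_left.1 H.disj_Bl hx)
    · exact absurd hx (Set.disjoint_left.1 H.disj_AB (e ▸ H.la_mem))
    · exact absurd (e ▸ hx) H.mid_B
  | right h =>
    rcases h.mem_or hs with e | ⟨e, rfl, rfl⟩ | ⟨e, rfl, rfl⟩
    · exact absurd e (Set.disjoint_left.1 H.disj_Br hx)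
    · exact absurd (H.mid ▸ e ▸ hx) H.mid_B
    · simp

theorem Branch.unique {p q p' q' : ℕ} {x : V}
    (hs : ∀ σ : G.Link, σ.IsSplit (A σ) (B σ) (l σ) (r σ))
    (h : Branch A B l r σ p q x) (h' : Branch A B l r σ p' q' x) : p = p' ∧ q = q' := by
  induction h generalizing p' q' with
  | left_end h => have := h'.of_mem_A hs h; simp [this]
  | right_end h => have := h'.of_mem_B hs h; simp [this]
  | left h ih =>
    cases h' with
    | left_end h' => exact (Branch.left h).of_mem_A hs h'
    | right_end h' => exact (Branch.left h).of_mem_B hs h'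
    | left h' => have := ih h'; simp [this]
    | right h' => have := h.left_right hs h'; omega
  | right h ih =>
    cases h' with
    | left_end h' => exact (Branch.right h).of_mem_A hs h'
    | right_end h' => exact (Branch.right h).of_mem_B hs h'
    | left h' => have := h'.left_right hs h; omega
    | right h' => have := ih h'; simp [this]

/-- The branch set of 1/0 is the union of the sets `A` along the iterated left links, each
containing the starting vertex of the next. -/
theorem Branch.reachable_left {p q : ℕ} {x : V}
    (hs : ∀ σ : G.Link, σ.IsSplit (A σ) (B σ) (l σ) (r σ))
    (h : Branch A B l r σ p q x) (hp : p = 1) (hq : q = 0) :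
    (G.within {x | Branch A B l r σ 1 0 x} ∅).Reachable σ.a x := by
  induction h with
  | @left_end σ x h => exact ((hs σ).A_conn x h).within_mono (fun y hy => .left_end hy) le_rfl
  | right_end h => omega
  | @left σ p q x h ih =>
    obtain rfl : q = 0 := hq
    obtain rfl : p = 1 := hp
    exact (((hs σ).A_conn _ (hs σ).la_mem).within_mono (fun y hy => .left_end hy) le_rfl).trans
      ((ih rfl rfl).within_mono (fun y hy => .left hy) le_rfl)
  | right h => omega

theorem Branch.reachable_right {p q : ℕ} {x : V}
    (hs : ∀ σ : G.Link, σ.IsSplit (A σ) (B σ) (l σ) (r σ))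
    (h : Branch A B l r σ p q x) (hp : p = 0) (hq : q = 1) :
    (G.within {x | Branch A B l r σ 0 1 x} ∅).Reachable σ.b x := by
  induction h with
  | @right_end σ x h => exact ((hs σ).B_conn x h).within_mono (fun y hy => .right_end hy) le_rfl
  | left_end h => omega
  | @right σ p q x h ih =>
    obtain rfl : p = 0 := hp
    obtain rfl : q = 1 := by omega
    exact (((hs σ).B_conn _ (hs σ).rb_mem).within_mono (fun y hy => .right_end hy) le_rfl).trans
      ((ih rfl rfl).within_mono (fun y hy => .right hy) le_rfl)
  | left h => omega

theorem branch_a (hs : ∀ σ : G.Link, σ.IsSplit (A σ) (B σ) (l σ) (r σ)) (σ : G.Link) :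
    Branch A B l r σ 1 0 σ.a := .left_end (hs σ).a_mem

theorem branch_b (hs : ∀ σ : G.Link, σ.IsSplit (A σ) (B σ) (l σ) (r σ)) (σ : G.Link) :
    Branch A B l r σ 0 1 σ.b := .right_end (hs σ).b_mem

theorem Branch.inv {p q : ℕ} {x : V} (h : Branch A B l r σ p q x) :
    (p = 1 ∧ q = 0) ∨ (p = 0 ∧ q = 1) ∨ (∃ p', p = p' + q ∧ Branch A B l r (l σ) p' q x) ∨
      ∃ q', q = p + q' ∧ Branch A B l r (r σ) p q' x := by
  cases h with
  | left_end h => simp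
  | right_end h => simp
  | left h => exact Or.inr (Or.inr (Or.inl ⟨_, rfl, h⟩))
  | right h => exact Or.inr (Or.inr (Or.inr ⟨_, rfl, h⟩))

/-- Euclid's algorithm: `p < q` descends to `r σ`, `p > q` to `l σ`. At 1/1 the end set of the left
half and the initial set of the right half are glued at the middle vertex. -/
theorem exists_branch_center (hs : ∀ σ : G.Link, σ.IsSplit (A σ) (B σ) (l σ) (r σ)) (σ : G.Link)
    {p q : ℕ} (hpq : Nat.Coprime p q) :
    ∃ c, Branch A B l r σ p q c ∧ ∀ x, Branch A B l r σ p q x →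
      (G.within {x | Branch A B l r σ p q x} ∅).Reachable c x := by
  induction hn : p + q using Nat.strong_induction_on generalizing p q σ with
  | h n ih =>
    subst hn
    rcases Nat.eq_zero_or_pos q with rfl | hq
    · obtain rfl : p = 1 := by simpa using hpq
      exact ⟨σ.a, branch_a hs σ, fun x hx => hx.reachable_left hs rfl rfl⟩
    rcases Nat.eq_zero_or_pos p with rfl | hp
    · obtain rfl : q = 1 := by simpa using hpq
      exact ⟨σ.b, branch_b hs σ, fun x hx => hx.reachable_right hs rfl rfl⟩
    rcases lt_trichotomy p q with h | rfl | h
    · obtain ⟨k, rfl⟩ := Nat.exists_eq_add_of_le h.le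
      obtain ⟨c, hc, hc'⟩ := ih (p + k) (by omega) (r σ) (by simpa using hpq) rfl
      refine ⟨c, .right hc, fun x hx => ?_⟩
      rcases hx.inv with h' | h' | ⟨p', h', -⟩ | ⟨q', h', hx⟩
      · omega
      · omega
      · omega
      · obtain rfl : k = q' := by omega
        exact (hc' x hx).within_mono (fun y hy => .right hy) le_rfl
    · obtain rfl : p = 1 := by simpa using hpq
      refine ⟨(l σ).b, .left (branch_b hs (l σ)), fun x hx => ?_⟩
      rcases hx.inv with h' | h' | ⟨p', h', hx⟩ | ⟨q', h', hx⟩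
      · omega
      · omega
      · obtain rfl : p' = 0 := by omega
        exact (hx.reachable_right hs rfl rfl).within_mono (fun y hy => .left hy) le_rfl
      · obtain rfl : q' = 0 := by omega
        rw [(hs σ).mid]
        exact (hx.reachable_left hs rfl rfl).within_mono (fun y hy => .right hy) le_rfl
    · obtain ⟨k, rfl⟩ := Nat.exists_eq_add_of_le' h.le
      obtain ⟨c, hc, hc'⟩ := ih (k + q) (by omega) (l σ) (by simpa using hpq) rfl
      refine ⟨c, .left hc, fun x hx => ?_⟩
      rcases hx.inv with h' | h' | ⟨p', h', hx⟩ | ⟨q', h', -⟩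
      · omega
      · omega
      · obtain rfl : k = p' := by omega
        exact (hc' x hx).within_mono (fun y hy => .left hy) le_rfl
      · omega

/-- A unimodular pair lies on one side of 1/1 and descends as a whole, until it is 1/0 and 0/1,
joined by the edge between `A` and `B`. -/
theorem exists_branch_adj (hs : ∀ σ : G.Link, σ.IsSplit (A σ) (B σ) (l σ) (r σ)) (σ : G.Link)
    {p q p' q' : ℕ} (h : p * q' = p' * q + 1) :
    ∃ x y, Branch A B l r σ p q x ∧ Branch A B l r σ p' q' y ∧ G.Adj x y := by
  induction hn : p + q + p' + q' using Nat.strong_induction_on generalizing p q p' q' σ with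
  | h n ih =>
    subst hn
    have hp : 0 < p := Nat.pos_of_ne_zero (by rintro rfl; omega)
    have hq' : 0 < q' := Nat.pos_of_ne_zero (by rintro rfl; omega)
    rcases Nat.lt_or_ge q p with h1 | h1
    · rcases Nat.lt_or_ge p' q' with h2 | h2
      -- Here `p * q' ≥ (q + 1) * (p' + 1)`, which exceeds `p' * q + 1` unless `q = p' = 0`.
      · obtain ⟨rfl, rfl⟩ : q = 0 ∧ p' = 0 := by constructor <;> nlinarith
        obtain ⟨rfl, rfl⟩ : p = 1 ∧ q' = 1 := by simpa using h
        obtain ⟨x, hx, y, hy, hxy⟩ := (hs σ).adj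
        exact ⟨x, y, .left_end hx, .right_end hy, hxy⟩
      · obtain ⟨k, rfl⟩ := Nat.exists_eq_add_of_le' h1.le
        obtain ⟨k', rfl⟩ := Nat.exists_eq_add_of_le' h2
        obtain ⟨x, y, hx, hy, hxy⟩ := ih (k + q + k' + q') (by omega) (l σ) (p := k) (q := q)
          (p' := k') (q' := q') (by linarith) rfl
        exact ⟨x, y, .left hx, .left hy, hxy⟩
    · have h2 : p' ≤ q' := by
        by_contra! hlt
        nlinarith
      obtain ⟨k, rfl⟩ := Nat.exists_eq_add_of_le h1
      obtain ⟨k', rfl⟩ := Nat.exists_eq_add_of_le h2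
      obtain ⟨x, y, hx, hy, hxy⟩ := ih (p + k + p' + k') (by omega) (r σ) (p := p) (q := k)
        (p' := p') (q' := k') (by linarith) rfl
      exact ⟨x, y, .right hx, .right hy, hxy⟩

end Link

end SimpleGraph

/-! ### The Farey graph as a minor -/

theorem fareyDen_nonneg (x : OnePoint ℚ) : 0 ≤ fareyDen x := by
  rcases x with _ | x
  · exact le_rfl
  · exact Int.natCast_nonneg _

theorem fareyNum_of_fareyDen_eq_zero {x : OnePoint ℚ} (h : fareyDen x = 0) : fareyNum x = 1 := by
  rcases x with _ | x
  · rfl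
  · exact absurd h (by simp [fareyDen])

theorem isCoprime_fareyNum_fareyDen (x : OnePoint ℚ) : IsCoprime (fareyNum x) (fareyDen x) := by
  rcases x with _ | x
  · exact isCoprime_one_left
  · exact Rat.isCoprime_num_den x

theorem farey_ext {x y : OnePoint ℚ} (h : fareyNum x * fareyDen y = fareyNum y * fareyDen x) :
    x = y := by
  rcases x with _ | x <;> rcases y with _ | y
  · rfl
  · simp [fareyNum, fareyDen] at h
  · simp [fareyNum, fareyDen, eq_comm] at h
  · exact congrArg some (Rat.eq_iff_mul_eq_mul.2 h)

theorem farey_ext' {x y : OnePoint ℚ} (hn : fareyNum x = fareyNum y)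
    (hd : fareyDen x = fareyDen y) : x = y :=
  farey_ext (by rw [hn, hd])

namespace SimpleGraph

variable {V : Type v} {G : SimpleGraph V}

theorem IsInfinitelyEdgeConnected.linked (h : G.IsInfinitelyEdgeConnected) (a b : V) :
    G.Linked a b {x | x ≠ a ∧ x ≠ b} := by
  intro F hF
  -- `IsEdgeConnected k` allows fewer than `k` deleted edges, hence the `+ 1`.
  have hlt : F.encard < ((F.ncard + 1 : ℕ) : ℕ∞) := by
    rw [← hF.cast_ncard_eq]
    exact_mod_cast Nat.lt_succ_self _
  refine (h.2 (F.ncard + 1) a b hlt).mono ?_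
  intro x y hxy
  rw [deleteEdges_adj] at hxy
  have huniv : ∀ z, z ∈ (insert a (insert b {x | x ≠ a ∧ x ≠ b}) : Set V) := by
    intro z
    by_cases h1 : z = a
    · simp [h1]
    by_cases h2 : z = b
    · simp [h2]
    · exact Or.inr (Or.inr ⟨h1, h2⟩)
  exact ⟨hxy.1, hxy.2, huniv x, huniv y⟩

namespace Link

variable {A B : G.Link → Set V} {l r : G.Link → G.Link} {σ : G.Link}

theorem exists_branch_adj_of_abs (hs : ∀ σ : G.Link, σ.IsSplit (A σ) (B σ) (l σ) (r σ))
    (σ : G.Link) {p q p' q' : ℕ} (h : |(p * q' - p' * q : ℤ)| = 1) :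
    ∃ x y, Branch A B l r σ p q x ∧ Branch A B l r σ p' q' y ∧ G.Adj x y := by
  rcases (abs_eq zero_le_one).1 h with h | h
  · refine exists_branch_adj hs σ ?_
    zify
    linarith
  · obtain ⟨x, y, hx, hy, hxy⟩ := exists_branch_adj hs σ (p := p') (q := q') (p' := p) (q' := q)
      (by zify; linarith)
    exact ⟨y, x, hy, hx, hxy.symm⟩

end Link

/-- The pairs `(p, q)` of the half of the Farey graph that are merged into the vertex `x` of the
Farey graph: merging `1 / 0` and `0 / 1` into `∞` turns this half into the whole graph. -/
def FareyIndex (x : OnePoint ℚ) (p q : ℕ) : Prop :=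
  (0 ≤ fareyNum x ∧ (p : ℤ) = fareyNum x + fareyDen x ∧ (q : ℤ) = fareyDen x) ∨
    (fareyNum x ≤ 0 ∧ (p : ℤ) = fareyDen x ∧ (q : ℤ) = fareyDen x - fareyNum x) ∨
    (fareyDen x = 0 ∧ p = 0 ∧ q = 1)

theorem FareyIndex.unique {x y : OnePoint ℚ} {p q : ℕ} (hx : FareyIndex x p q)
    (hy : FareyIndex y p q) : x = y := by
  have hx0 := @fareyNum_of_fareyDen_eq_zero x
  have hy0 := @fareyNum_of_fareyDen_eq_zero y
  have hx1 := fareyDen_nonneg x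
  have hy1 := fareyDen_nonneg y
  unfold FareyIndex at hx hy
  apply farey_ext' <;> omega

/-- The index is `x + 1` for `x ≥ 0` and `1 / (1 - x)` for `x ≤ 0`; these agree at 0, so only ∞ has
two indices. -/
theorem exists_fareyIndex {x : OnePoint ℚ} (h : fareyDen x ≠ 0) :
    ∃ p q, FareyIndex x p q ∧ Nat.Coprime p q ∧
      ∀ p' q', FareyIndex x p' q' → p' = p ∧ q' = q := by
  have hx1 := fareyDen_nonneg x
  have hcop := isCoprime_fareyNum_fareyDen x
  unfold FareyIndex
  rcases le_total 0 (fareyNum x) with h0 | h0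
  · refine ⟨(fareyNum x + fareyDen x).toNat, (fareyDen x).toNat, by omega, ?_, by omega⟩
    rw [← Nat.isCoprime_iff_coprime, Int.toNat_of_nonneg (by omega), Int.toNat_of_nonneg hx1]
    simpa using hcop.add_mul_left_left 1
  · refine ⟨(fareyDen x).toNat, (fareyDen x - fareyNum x).toNat, by omega, ?_, by omega⟩
    rw [← Nat.isCoprime_iff_coprime, Int.toNat_of_nonneg (by omega), Int.toNat_of_nonneg (by omega)]
    have := (hcop.neg_left.symm).add_mul_left_right 1
    rwa [mul_one, neg_add_eq_sub] at this

/-- The Farey graph is a minor of every `Π`-graph. -/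
theorem IsPiGraph.fareyGraph_isMinorOf (hG : G.IsPiGraph) : fareyGraph.IsMinorOf G := by
  have ⟨⟨hV, _⟩, hpath⟩ := hG
  obtain ⟨a, b, hab⟩ := hV
  choose A B l r hs using Link.exists_isSplit hpath
  let σ : G.Link := ⟨a, b, _, hab, fun h => h.1 rfl, fun h => h.2 rfl, hG.1.linked a b⟩
  refine ⟨fun x => {y | ∃ p q, FareyIndex x p q ∧ Link.Branch A B l r σ p q y}, ?_, ?_, ?_⟩
  · intro x
    by_cases hx : fareyDen x = 0
    · have hx' := fareyNum_of_fareyDen_eq_zero hx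
      have h1 : FareyIndex x 1 0 := Or.inl (by simp [hx, hx'])
      have h2 : FareyIndex x 0 1 := Or.inr (Or.inr ⟨hx, rfl, rfl⟩)
      set S := {y | ∃ p q, FareyIndex x p q ∧ Link.Branch A B l r σ p q y}
      have hS1 : {y | Link.Branch A B l r σ 1 0 y} ⊆ S := fun y hy => ⟨_, _, h1, hy⟩
      have hS2 : {y | Link.Branch A B l r σ 0 1 y} ⊆ S := fun y hy => ⟨_, _, h2, hy⟩
      refine connected_induce_of_within (F := ∅) (c := σ.a) (hS1 (Link.branch_a hs σ)) ?_
      rintro y ⟨p, q, hpq, hy⟩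
      obtain ⟨u, v, hu, hv, huv⟩ := Link.exists_branch_adj_of_abs hs σ (p := 1) (q := 0) (p' := 0)
        (q' := 1) (by simp)
      have : (p = 1 ∧ q = 0) ∨ (p = 0 ∧ q = 1) := by
        unfold FareyIndex at hpq
        omega
      rcases this with ⟨rfl, rfl⟩ | ⟨rfl, rfl⟩
      · exact (hy.reachable_left hs rfl rfl).within_mono hS1 le_rfl
      · refine ((hu.reachable_left hs rfl rfl).within_mono hS1 le_rfl).trans (Reachable.trans
          (Adj.reachable ⟨huv, by simp, hS1 hu, hS2 hv⟩) ?_)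
        exact ((hv.reachable_right hs rfl rfl).symm.trans
          (hy.reachable_right hs rfl rfl)).within_mono hS2 le_rfl
    · obtain ⟨p, q, hpq, hcop, huniq⟩ := exists_fareyIndex hx
      obtain ⟨c, hc, hc'⟩ := Link.exists_branch_center hs σ hcop
      refine connected_induce_of_within (F := ∅) (c := c) ⟨p, q, hpq, hc⟩ ?_
      rintro y ⟨p', q', hpq', hy⟩
      obtain ⟨rfl, rfl⟩ := huniq _ _ hpq'
      exact (hc' y hy).within_mono (fun z hz => ⟨_, _, hpq, hz⟩) le_rfl
  · intro x y hxy
    rw [Set.disjoint_left]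
    rintro z ⟨p, q, hpq, hz⟩ ⟨p', q', hpq', hz'⟩
    obtain ⟨rfl, rfl⟩ := hz.unique hs hz'
    exact hxy (hpq.unique hpq')
  · intro x y hxy
    change |fareyNum x * fareyDen y - fareyNum y * fareyDen x| = 1 at hxy
    suffices ∃ p q p' q', FareyIndex x p q ∧ FareyIndex y p' q' ∧
        |(p * q' - p' * q : ℤ)| = 1 by
      obtain ⟨p, q, p', q', hx, hy, h⟩ := this
      obtain ⟨u, v, hu, hv, huv⟩ := Link.exists_branch_adj_of_abs hs σ h
      exact ⟨u, ⟨_, _, hx, hu⟩, v, ⟨_, _, hy, hv⟩, huv⟩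
    have hx0 := @fareyNum_of_fareyDen_eq_zero x
    have hy0 := @fareyNum_of_fareyDen_eq_zero y
    have hx1 := fareyDen_nonneg x
    have hy1 := fareyDen_nonneg y
    unfold FareyIndex
    generalize fareyNum x = n at *
    generalize fareyDen x = d at *
    generalize fareyNum y = n' at *
    generalize fareyDen y = d' at *
    -- Both index maps are unimodular, so the determinant carries over on each side of 0.
    by_cases h1 : 0 ≤ n ∧ 0 ≤ n'
    · refine ⟨(n + d).toNat, d.toNat, (n' + d').toNat, d'.toNat, by omega, by omega, ?_⟩
      rw [Int.toNat_of_nonneg hx1, Int.toNat_of_nonneg hy1, Int.toNat_of_nonneg (by omega),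
        Int.toNat_of_nonneg (by omega), ← hxy]
      congr 1
      ring
    by_cases h2 : n ≤ 0 ∧ n' ≤ 0
    · refine ⟨d.toNat, (d - n).toNat, d'.toNat, (d' - n').toNat, by omega, by omega, ?_⟩
      rw [Int.toNat_of_nonneg hx1, Int.toNat_of_nonneg hy1, Int.toNat_of_nonneg (by omega),
        Int.toNat_of_nonneg (by omega), ← hxy]
      congr 1
      ring
    -- The other end is now negative, so ∞ must be represented by 0/1.
    by_cases h3 : d = 0
    · obtain rfl := hx0 h3
      subst h3
      refine ⟨0, 1, d'.toNat, (d' - n').toNat, by omega, by omega, ?_⟩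
      rw [Int.toNat_of_nonneg hy1, Int.toNat_of_nonneg (by omega)]
      simpa using hxy
    by_cases h4 : d' = 0
    · obtain rfl := hy0 h4
      subst h4
      refine ⟨d.toNat, (d - n).toNat, 0, 1, by omega, by omega, ?_⟩
      rw [Int.toNat_of_nonneg hx1, Int.toNat_of_nonneg (by omega)]
      simpa using hxy
    -- Finite vertices on opposite sides of 0: `n * d'` and `n' * d` have opposite signs and differ
    -- by at least 2.
    exfalso
    have hd : 0 < d := by omega
    have hd' : 0 < d' := by omega
    rcases lt_or_ge 0 n with hn | hn
    · have hn' : n' < 0 := by omega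
      have e1 := mul_pos hn hd'
      have e2 := mul_neg_of_neg_of_pos hn' hd
      rw [abs_of_pos (by linarith)] at hxy
      omega
    · have hn : n < 0 := by omega
      have hn' : 0 < n' := by omega
      have e1 := mul_neg_of_neg_of_pos hn hd'
      have e2 := mul_pos hn' hd
      rw [abs_of_neg (by linarith)] at hxy
      omega

end SimpleGraph

/-! ### Infinite edge-connectivity of the Farey graph -/

/-- `(p, q)` are homogeneous coordinates in lowest terms of the vertex `x` of the Farey graph. -/
def FareyCoord (x : OnePoint ℚ) (p q : ℤ) : Prop :=
  (fareyNum x = p ∧ fareyDen x = q) ∨ (fareyNum x = -p ∧ fareyDen x = -q)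

theorem exists_fareyCoord {p q : ℤ} (h : IsCoprime p q) : ∃ x, FareyCoord x p q := by
  have key : ∀ p q : ℤ, IsCoprime p q → 0 < q →
      ∃ x : OnePoint ℚ, fareyNum x = p ∧ fareyDen x = q := by
    intro p q h hq
    have hcop : Nat.Coprime p.natAbs q.natAbs := Int.isCoprime_iff_gcd_eq_one.1 h
    exact ⟨some (Rat.mk' p q.natAbs (by omega) hcop), rfl, by
      change ((q.natAbs : ℕ) : ℤ) = q
      omega⟩
  rcases lt_trichotomy q 0 with hq | rfl | hq
  · obtain ⟨x, hx⟩ := key (-p) (-q) h.neg_neg (by omega)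
    exact ⟨x, Or.inr hx⟩
  · rcases Int.isUnit_iff.1 (isCoprime_zero_right.1 h) with rfl | rfl
    · exact ⟨none, Or.inl ⟨rfl, rfl⟩⟩
    · exact ⟨none, Or.inr ⟨rfl, rfl⟩⟩
  · obtain ⟨x, hx⟩ := key p q h hq
    exact ⟨x, Or.inl hx⟩

theorem FareyCoord.abs_det {x : OnePoint ℚ} {p q : ℤ} (h : FareyCoord x p q) (r s : ℤ) :
    |fareyNum x * s - r * fareyDen x| = |p * s - r * q| := by
  rcases h with ⟨h1, h2⟩ | ⟨h1, h2⟩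
  · rw [h1, h2]
  · rw [h1, h2, ← abs_neg]
    congr 1
    ring

theorem FareyCoord.adj {x y : OnePoint ℚ} {p q r s : ℤ} (hx : FareyCoord x p q)
    (hy : FareyCoord y r s) (h : |p * s - r * q| = 1) : fareyGraph.Adj x y := by
  exact (hx.abs_det _ _).trans ((abs_sub_comm _ _).trans ((hy.abs_det p q).trans
    ((abs_sub_comm _ _).trans h)))

theorem isCoprime_of_abs_det {p q r s : ℤ} (h : |p * s - r * q| = 1) : IsCoprime p q := by
  rcases (abs_eq zero_le_one).1 h with h | h
  · exact ⟨s, -r, by linarith⟩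
  · exact ⟨-s, r, by linarith⟩

/-- Adding multiples of `x` to a Bézout solution keeps the determinant and brings the denominator
below that of `x`. -/
theorem exists_fareyGraph_adj_fareyDen_lt {x : OnePoint ℚ} (hx : 0 < fareyDen x) :
    ∃ y, fareyGraph.Adj x y ∧ fareyDen y < fareyDen x := by
  obtain ⟨s, r, h⟩ := isCoprime_fareyNum_fareyDen x
  set n := fareyNum x with hn
  set d := fareyDen x with hd
  have h0 := Int.emod_nonneg s hx.ne'
  have h1 := Int.emod_lt_of_pos s hx
  have hs := Int.emod_add_mul_ediv s d
  have hdet : |n * (s % d) - (-r - n * (s / d)) * d| = 1 := by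
    have : n * (s % d) - (-r - n * (s / d)) * d = n * (s % d + d * (s / d)) + r * d := by ring
    rw [this, hs, mul_comm n, h, abs_one]
  obtain ⟨y, hy⟩ := exists_fareyCoord
    (isCoprime_of_abs_det (p := -r - n * (s / d)) (q := s % d) (r := n) (s := d)
      (by rw [abs_sub_comm]; exact hdet))
  refine ⟨y, FareyCoord.adj (Or.inl ⟨rfl, rfl⟩) hy hdet, ?_⟩
  rcases hy with ⟨-, h2⟩ | ⟨-, h2⟩ <;> omega

theorem fareyGraph_preconnected : fareyGraph.Preconnected := by
  have key : ∀ (n : ℕ) (x : OnePoint ℚ), fareyDen x = n → fareyGraph.Reachable x none := by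
    intro n
    induction n using Nat.strong_induction_on with
    | h n ih =>
      intro x hx
      rcases Nat.eq_zero_or_pos n with rfl | hn
      · have hx' : fareyDen x = 0 := hx
        obtain rfl : x = none := farey_ext' (fareyNum_of_fareyDen_eq_zero hx') hx'
        exact SimpleGraph.Reachable.refl _
      · obtain ⟨y, hxy, hlt⟩ := exists_fareyGraph_adj_fareyDen_lt (x := x) (by omega)
        have := fareyDen_nonneg y
        exact hxy.reachable.trans (ih (fareyDen y).toNat (by omega) y (by omega))
  have hden : ∀ x, fareyDen x = (fareyDen x).toNat := fun x =>
    (Int.toNat_of_nonneg (fareyDen_nonneg x)).symm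
  exact fun x y => (key _ x (hden x)).trans (key _ y (hden y)).symm

/-- In the basis `u, v`, replacing an edge by the path through its mediant raises the sum of the
coordinates. After enough rounds this sum exceeds its maximum over `F`. -/
theorem fareyGraph_reachable_deleteEdges_of_adj {F : Set (Sym2 (OnePoint ℚ))} (hF : F.Finite)
    {u v : OnePoint ℚ} (huv : fareyGraph.Adj u v) : (fareyGraph.deleteEdges F).Reachable u v := by
  change |fareyNum u * fareyDen v - fareyNum v * fareyDen u| = 1 at huv
  set a := fareyNum u
  set b := fareyDen u
  set c := fareyNum v
  set d := fareyDen v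
  -- By Cramer's rule, this is the sum of the absolute values of the coordinates of `x` in the basis
  -- `u, v`.
  let size : OnePoint ℚ → ℤ := fun x =>
    |fareyNum x * d - c * fareyDen x| + |fareyNum x * b - a * fareyDen x|
  have hsize : ∀ (x : OnePoint ℚ) (X Y : ℕ), FareyCoord x (X * a + Y * c) (X * b + Y * d) →
      size x = X + Y := by
    intro x X Y hx
    change |_| + |_| = _
    rw [hx.abs_det, hx.abs_det]
    have e1 : (X * a + Y * c) * d - c * (X * b + Y * d) = X * (a * d - c * b) := by ring
    have e2 : (X * a + Y * c) * b - a * (X * b + Y * d) = -(Y * (a * d - c * b)) := by ring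
    rw [e1, e2, abs_neg, abs_mul, abs_mul, huv]
    simp
  let f : Sym2 (OnePoint ℚ) → ℤ := Sym2.lift ⟨fun x y => size x + size y, fun x y => add_comm _ _⟩
  obtain ⟨N, hN⟩ := (hF.image f).bddAbove
  have hN' : ∀ x y, s(x, y) ∈ F → size x + size y ≤ N := fun x y h =>
    hN (Set.mem_image_of_mem f h)
  -- `k` bounds the number of subdivision rounds still needed.
  have key : ∀ (k X Y X' Y' : ℕ), |(X * Y' - X' * Y : ℤ)| = 1 →
      N < X + Y + X' + Y' + k → ∀ x y, FareyCoord x (X * a + Y * c) (X * b + Y * d) →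
      FareyCoord y (X' * a + Y' * c) (X' * b + Y' * d) →
      (fareyGraph.deleteEdges F).Reachable x y := by
    have hdet : ∀ X Y X' Y' : ℤ, |X * Y' - X' * Y| = 1 → |(X * a + Y * c) * (X' * b + Y' * d) -
        (X' * a + Y' * c) * (X * b + Y * d)| = 1 := by
      intro X Y X' Y' h
      have : (X * a + Y * c) * (X' * b + Y' * d) - (X' * a + Y' * c) * (X * b + Y * d) =
        (X * Y' - X' * Y) * (a * d - c * b) := by ring
      rw [this, abs_mul, h, huv, mul_one]
    intro k
    induction k with
    | zero =>
      intro X Y X' Y' h hlt x y hx hy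
      refine SimpleGraph.Adj.reachable ?_
      rw [SimpleGraph.deleteEdges_adj]
      refine ⟨hx.adj hy (hdet _ _ _ _ h), fun hxy => ?_⟩
      have := hN' x y hxy
      rw [hsize x X Y hx, hsize y X' Y' hy] at this
      push_cast at hlt
      linarith
    | succ k ih =>
      intro X Y X' Y' h hlt x y hx hy
      have h1 : |(X * (Y + Y' : ℕ) - (X + X' : ℕ) * Y : ℤ)| = 1 := by
        rw [← h]
        congr 1
        push_cast
        ring
      have h2 : |((X + X' : ℕ) * Y' - X' * (Y + Y' : ℕ) : ℤ)| = 1 := by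
        rw [← h]
        congr 1
        push_cast
        ring
      have hpos : 0 < X + Y := by
        by_contra hc
        obtain ⟨rfl, rfl⟩ : X = 0 ∧ Y = 0 := by omega
        simp at h
      have hpos' : 0 < X' + Y' := by
        by_contra hc
        obtain ⟨rfl, rfl⟩ : X' = 0 ∧ Y' = 0 := by omega
        simp at h
      obtain ⟨m, hm⟩ := exists_fareyCoord (isCoprime_of_abs_det (hdet _ _ _ _ h2))
      exact (ih X Y (X + X') (Y + Y') h1 (by push_cast at hlt ⊢; omega) x m hx hm).trans
        (ih (X + X') (Y + Y') X' Y' h2 (by push_cast at hlt ⊢; omega) m y hm hy)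
  refine key (N + 1).toNat 1 0 0 1 (by simp) (by omega) u v (Or.inl ?_) (Or.inl ?_) <;>
    simp [a, b, c, d]

theorem fareyGraph_isInfinitelyEdgeConnected : fareyGraph.IsInfinitelyEdgeConnected := by
  refine ⟨inferInstance, fun k x y F hF => ?_⟩
  have hfin : F.Finite := Set.finite_of_encard_le_coe hF.le
  have h := fareyGraph_preconnected x y
  rw [SimpleGraph.reachable_iff_reflTransGen] at h
  induction h with
  | refl => exact SimpleGraph.Reachable.refl _
  | tail _ hyz ih => exact ih.trans (fareyGraph_reachable_deleteEdges_of_adj hfin hyz)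

/-! ### Finite separation in the Farey graph -/

namespace SimpleGraph

variable {V : Type v} {G : SimpleGraph V} {a b : V}

/-- A discrete intermediate value theorem: the only edge that skips zero starts at `a`, which the
walk avoids. -/
theorem Walk.exists_mem_support_eq_zero {g : V → ℤ}
    (hadj : ∀ x y, G.Adj x y → 0 < g x → g y < 0 → x = a ∧ y = b) {u v : V} (p : G.Walk u v)
    (hu : 0 ≤ g u) (hv : g v < 0) (ha : a ∉ p.support) : ∃ z ∈ p.support, g z = 0 := by
  induction p with
  | nil => omega
  | @cons u c v h p ih =>
    rcases hu.eq_or_lt with hu | hu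
    · exact ⟨u, by simp, hu.symm⟩
    · rw [Walk.support_cons, List.mem_cons, not_or] at ha
      have hc : 0 ≤ g c := by
        by_contra! hc
        exact ha.1 (hadj u c h hu hc).1.symm
      obtain ⟨z, hz, hz'⟩ := ih hc hv ha.2
      exact ⟨z, by simp [hz], hz'⟩

/-- If a function with finitely many zeros is positive at `a` and negative at `b`, and only the edge
from `a` to `b` joins a positive to a negative vertex, then `a` and `b` are finitely separated. -/
theorem not_hasInfinitelyManyIndependentPaths_of_sign {g : V → ℤ} (hfin : {x | g x = 0}.Finite)
    (ha : 0 < g a) (hb : g b < 0)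
    (hadj : ∀ x y, G.Adj x y → 0 < g x → g y < 0 → x = a ∧ y = b) :
    ¬ G.HasInfinitelyManyIndependentPaths a b := by
  rintro ⟨S, hS, hind⟩
  have hab : a ≠ b := by
    rintro rfl
    omega
  have hpath : ∀ P : G.Path a b, (∃ z ∈ P.1.support, g z = 0) ∨
      ∃ h : G.Adj a b, P.1 = Walk.cons h Walk.nil := by
    rintro ⟨P, hP⟩
    obtain ⟨c, h, p, rfl⟩ := Walk.exists_eq_cons_of_ne hab P
    rw [Walk.cons_isPath_iff] at hP
    rcases lt_or_ge (g c) 0 with hc | hc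
    · obtain ⟨-, rfl⟩ := hadj a c h ha hc
      refine Or.inr ⟨h, ?_⟩
      obtain rfl := (Walk.isPath_iff_nil.1 hP.1).eq_nil
      rfl
    · obtain ⟨z, hz, hz'⟩ := p.exists_mem_support_eq_zero hadj hc hb hP.2
      exact Or.inl ⟨z, by simp [hz], hz'⟩
  have hsub : {P : G.Path a b | ∃ h : G.Adj a b, P.1 = Walk.cons h Walk.nil}.Subsingleton := by
    rintro P ⟨h, hP⟩ Q ⟨h', hQ⟩
    exact Subtype.ext (hP.trans hQ.symm)
  have hinf : (S \ {P : G.Path a b | ∃ h : G.Adj a b, P.1 = Walk.cons h Walk.nil}).Infinite :=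
    hS.sdiff hsub.finite
  have hz : ∀ P : G.Path a b, ∃ z, P ∈ S \ {P | ∃ h : G.Adj a b, P.1 = Walk.cons h Walk.nil} →
      z ∈ P.1.support ∧ g z = 0 := by
    intro P
    rcases hpath P with ⟨z, hz⟩ | h
    · exact ⟨z, fun _ => hz⟩
    · exact ⟨a, fun hP => absurd h hP.2⟩
  choose f hf using hz
  -- Two paths share a zero of `g`, which is neither `a` nor `b`.
  obtain ⟨P, hP, Q, hQ, hPQ, he⟩ := hinf.exists_ne_map_eq_of_mapsTo
    (fun P hP => (hf P hP).2) hfin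
  have h0 := (hf P hP).2
  rcases hind hP.1 hQ.1 hPQ (f P) (hf P hP).1 (he ▸ (hf Q hQ).1) with h | h <;> rw [h] at h0 <;>
    omega

end SimpleGraph

theorem farey_eq_of_det_eq_zero {x y : OnePoint ℚ} {r s : ℤ} (hrs : r ≠ 0 ∨ s ≠ 0)
    (hx : fareyNum x * s - r * fareyDen x = 0) (hy : fareyNum y * s - r * fareyDen y = 0) :
    x = y := by
  apply farey_ext
  rcases hrs with h | h <;> apply mul_left_cancel₀ h
  · linear_combination fareyNum y * hx - fareyNum x * hy
  · linear_combination fareyDen y * hx - fareyDen x * hy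

theorem finite_zeros_det_mul_det {p q r s : ℤ} (hpq : p ≠ 0 ∨ q ≠ 0) (hrs : r ≠ 0 ∨ s ≠ 0) :
    {x | (fareyNum x * q - p * fareyDen x) * (fareyNum x * s - r * fareyDen x) = 0}.Finite := by
  have h1 : {x | fareyNum x * q - p * fareyDen x = 0}.Finite :=
    Set.Subsingleton.finite fun x hx y hy => farey_eq_of_det_eq_zero hpq hx hy
  have h2 : {x | fareyNum x * s - r * fareyDen x = 0}.Finite :=
    Set.Subsingleton.finite fun x hx y hy => farey_eq_of_det_eq_zero hrs hx hy
  exact (h1.union h2).subset fun x hx => mul_eq_zero.1 hx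

/-- If `(X, Y)` and `(X', Y')` lie in the interiors of adjacent quadrants, then their determinant is
not a unit. -/
theorem abs_det_ne_one_of_sign {X Y X' Y' : ℤ} (h : 0 < X * Y) (h' : X' * Y' < 0) :
    |X * Y' - X' * Y| ≠ 1 := by
  intro hdet
  have h1 : (X * Y' - X' * Y) ^ 2 = 1 := by rw [← sq_abs, hdet, one_pow]
  have h2 : (X * Y) * (X' * Y') ≤ -1 := by nlinarith
  have hX : X ≠ 0 := by rintro rfl; simp at h
  have hY' : Y' ≠ 0 := by rintro rfl; simp at h'
  nlinarith [sq_nonneg (X * Y'), sq_nonneg (X' * Y)]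

theorem fareyGraph_not_hasInfinitelyManyIndependentPaths {a b : OnePoint ℚ} (hab : a ≠ b) :
    ¬ fareyGraph.HasInfinitelyManyIndependentPaths a b := by
  by_cases hadj : fareyGraph.Adj a b
  · have hdet : |fareyNum a * fareyDen b - fareyNum b * fareyDen a| = 1 := hadj
    have hsq : (fareyNum a * fareyDen b - fareyNum b * fareyDen a) ^ 2 = 1 := by
      rw [← sq_abs, hdet, one_pow]
    set D := fareyNum a * fareyDen b - fareyNum b * fareyDen a with hD
    have hD0 : D ≠ 0 := by
      intro h
      rw [h] at hsq
      norm_num at hsq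
    -- With `X = det(x, b)` and `Y = det(x, a)` this is `(X - Y) * (X + Y)`; its zeros are the
    -- common neighbours `b - a` and `b + a`.
    refine SimpleGraph.not_hasInfinitelyManyIndependentPaths_of_sign
      (g := fun x => (fareyNum x * (fareyDen b - fareyDen a) -
        (fareyNum b - fareyNum a) * fareyDen x) * (fareyNum x * (fareyDen b + fareyDen a) -
        (fareyNum b + fareyNum a) * fareyDen x)) (finite_zeros_det_mul_det ?_ ?_) ?_ ?_ ?_
    · by_contra! h
      apply hD0
      linear_combination fareyNum a * h.2 - fareyDen a * h.1
    · by_contra! h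
      apply hD0
      linear_combination fareyNum a * h.2 - fareyDen a * h.1
    · have : (fareyNum a * (fareyDen b - fareyDen a) -
        (fareyNum b - fareyNum a) * fareyDen a) * (fareyNum a * (fareyDen b + fareyDen a) -
        (fareyNum b + fareyNum a) * fareyDen a) = D ^ 2 := by rw [hD]; ring
      rw [this, hsq]
      exact one_pos
    · have : (fareyNum b * (fareyDen b - fareyDen a) -
        (fareyNum b - fareyNum a) * fareyDen b) * (fareyNum b * (fareyDen b + fareyDen a) -
        (fareyNum b + fareyNum a) * fareyDen b) = - D ^ 2 := by rw [hD]; ring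
      rw [this, hsq]
      norm_num
    · intro x y hxy hx hy
      have hxy : |fareyNum x * fareyDen y - fareyNum y * fareyDen x| = 1 := hxy
      have key : ∀ X Y X' Y' : ℤ, (X - Y) * (X + Y) > 0 → (X' - Y') * (X' + Y') < 0 →
          |X * Y' - X' * Y| = 1 → Y = 0 ∧ X' = 0 := by
        intro X Y X' Y' h h' hdet
        have h1 : |Y| < |X| := sq_lt_sq.1 (by linarith)
        have h2 : |X'| < |Y'| := sq_lt_sq.1 (by linarith)
        have h3 := abs_sub_abs_le_abs_sub (X * Y') (X' * Y)
        rw [hdet, abs_mul, abs_mul] at h3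
        have h4 := abs_nonneg Y
        have h5 := abs_nonneg X'
        rw [← abs_eq_zero, ← abs_eq_zero (a := X')]
        constructor <;> nlinarith
      obtain ⟨h1, h2⟩ := key (fareyNum x * fareyDen b - fareyNum b * fareyDen x)
        (fareyNum x * fareyDen a - fareyNum a * fareyDen x)
        (fareyNum y * fareyDen b - fareyNum b * fareyDen y)
        (fareyNum y * fareyDen a - fareyNum a * fareyDen y)
        (by convert hx using 1; ring) (by convert hy using 1; ring) (by
          rw [← hxy, ← mul_one |fareyNum x * fareyDen y - _|, ← hdet, ← abs_mul, abs_sub_comm]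
          congr 1
          ring)
      exact ⟨farey_ext (by linarith), farey_ext (by linarith)⟩
  · have hne : |fareyNum a * fareyDen b - fareyNum b * fareyDen a| ≠ 1 := hadj
    -- `(r, s)` is a neighbour of `a`, and so is every `(r, s) + k • a`; its determinant with `b` is
    -- `e + k * t`.
    obtain ⟨s, r', hbez⟩ := isCoprime_fareyNum_fareyDen a
    obtain ⟨r, rfl⟩ : ∃ r, r' = -r := ⟨-r', by ring⟩
    set t := fareyNum b * fareyDen a - fareyNum a * fareyDen b with ht
    have ht0 : t ≠ 0 := fun h => hab (farey_ext (by linarith))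
    have ht1 : ¬ IsUnit t := by
      rw [Int.isUnit_iff_abs_eq, ht, abs_sub_comm]
      exact hne
    set e := fareyNum b * s - r * fareyDen b with he
    have hbn : fareyNum b = e * fareyNum a - t * r := by
      rw [he, ht]
      linear_combination -fareyNum b * hbez
    have hbd : fareyDen b = e * fareyDen a - t * s := by
      rw [he, ht]
      linear_combination -fareyDen b * hbez
    have hdvd : ¬ t ∣ e := by
      intro h
      refine ht1 ((isCoprime_fareyNum_fareyDen b).isUnit_of_dvd' ?_ ?_)
      · rw [hbn]
        exact dvd_sub (h.mul_right _) (dvd_mul_right _ _)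
      · rw [hbd]
        exact dvd_sub (h.mul_right _) (dvd_mul_right _ _)
    -- As `t` does not divide `e`, the progression `e + k * t` jumps over 0, so `b` lies between two
    -- consecutive neighbours of `a`.
    obtain ⟨k, hk⟩ : ∃ k : ℤ, (e + k * t) * (e + (k + 1) * t) < 0 := by
      have h1 := Int.emod_add_mul_ediv e t
      have h2 := Int.emod_nonneg e ht0
      have h3 : e % t ≠ 0 := fun h => hdvd (Int.dvd_of_emod_eq_zero h)
      have h4 := Int.emod_lt_abs e ht0
      rcases abs_cases t with ⟨h5, -⟩ | ⟨h5, -⟩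
      · refine ⟨-(e / t) - 1, ?_⟩
        have e1 : e + (-(e / t) - 1) * t = e % t - t := by linear_combination -h1
        have e2 : e + (-(e / t) - 1 + 1) * t = e % t := by linear_combination -h1
        rw [e1, e2]
        exact mul_neg_of_neg_of_pos (by omega) (by omega)
      · refine ⟨-(e / t), ?_⟩
        have e1 : e + (-(e / t)) * t = e % t := by linear_combination -h1
        have e2 : e + (-(e / t) + 1) * t = e % t + t := by linear_combination -h1
        rw [e1, e2]
        exact mul_neg_of_pos_of_neg (by omega) (by omega)
    refine SimpleGraph.not_hasInfinitelyManyIndependentPaths_of_sign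
      (g := fun x => (fareyNum x * (s + k * fareyDen a) - (r + k * fareyNum a) * fareyDen x) *
        (fareyNum x * (s + (k + 1) * fareyDen a) - (r + (k + 1) * fareyNum a) * fareyDen x))
      (finite_zeros_det_mul_det ?_ ?_) ?_ ?_ ?_
    · by_contra! h
      have : (1 : ℤ) = 0 := by linear_combination -hbez + fareyNum a * h.2 - fareyDen a * h.1
      exact one_ne_zero this
    · by_contra! h
      have : (1 : ℤ) = 0 := by linear_combination -hbez + fareyNum a * h.2 - fareyDen a * h.1
      exact one_ne_zero this
    · have e1 : fareyNum a * (s + k * fareyDen a) - (r + k * fareyNum a) * fareyDen a = 1 := by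
        linear_combination hbez
      have e2 : fareyNum a * (s + (k + 1) * fareyDen a) -
          (r + (k + 1) * fareyNum a) * fareyDen a = 1 := by
        linear_combination hbez
      rw [e1, e2]
      norm_num
    · convert hk using 2
      · rw [he, ht]
        ring
      · rw [he, ht]
        ring
    · intro x y hxy hx hy
      have hxy : |fareyNum x * fareyDen y - fareyNum y * fareyDen x| = 1 := hxy
      refine absurd ?_ (abs_det_ne_one_of_sign hx hy)
      rw [abs_sub_comm]
      refine Eq.trans (congrArg abs ?_) hxy
      linear_combination (fareyNum x * fareyDen y - fareyNum y * fareyDen x) * hbez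

theorem fareyGraph_isPiGraph : fareyGraph.IsPiGraph :=
  ⟨fareyGraph_isInfinitelyEdgeConnected,
    fun _ _ => fareyGraph_not_hasInfinitelyManyIndependentPaths⟩

/-! ### Invariance under isomorphism -/

namespace SimpleGraph

variable {V : Type v} {W : Type w} {G : SimpleGraph V} {H : SimpleGraph W}

theorem IsInfinitelyEdgeConnected.of_iso (e : G ≃g H) (h : G.IsInfinitelyEdgeConnected) :
    H.IsInfinitelyEdgeConnected := by
  obtain ⟨hV, hG⟩ := h
  refine ⟨e.toEquiv.symm.nontrivial, fun k x y F hF => ?_⟩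
  have hF' : (Sym2.map e ⁻¹' F).encard < k := by
    rw [← (Sym2.map.injective e.injective).encard_image]
    exact (Set.encard_le_encard (Set.image_preimage_subset _ _)).trans_lt hF
  let f : G.deleteEdges (Sym2.map e ⁻¹' F) →g H.deleteEdges F :=
    ⟨e, fun {a b} hab => by
      rw [deleteEdges_adj] at hab ⊢
      exact ⟨e.map_adj_iff.2 hab.1, hab.2⟩⟩
  have := (hG k (e.symm x) (e.symm y) hF').map f
  simpa [f] using this

theorem HasInfinitelyManyIndependentPaths.map (f : G ↪g H) {a b : V}
    (h : G.HasInfinitelyManyIndependentPaths a b) :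
    H.HasInfinitelyManyIndependentPaths (f a) (f b) := by
  obtain ⟨S, hS, hind⟩ := h
  have hinj : Function.Injective (Path.mapEmbedding f : G.Path a b → H.Path (f a) (f b)) :=
    Path.mapEmbedding_injective f a b
  refine ⟨Path.mapEmbedding f '' S, hS.image hinj.injOn, ?_⟩
  rintro _ ⟨P, hP, rfl⟩ _ ⟨Q, hQ, rfl⟩ hPQ x hx hx'
  simp only [Path.mapEmbedding_coe, Walk.support_map, List.mem_map] at hx hx'
  obtain ⟨y, hy, rfl⟩ := hx
  obtain ⟨z, hz, hyz⟩ := hx'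
  obtain rfl := f.injective hyz
  rcases hind hP hQ (fun h => hPQ (congrArg _ h)) z hy hz with h | h <;> simp [h]

theorem IsPiGraph.of_iso (e : G ≃g H) (h : G.IsPiGraph) : H.IsPiGraph :=
  ⟨h.1.of_iso e, fun _ _ hab hinf =>
    h.2 _ _ (e.symm.injective.ne hab) (hinf.map e.symm.toEmbedding)⟩

theorem IsMinorOf.of_iso {U : Type u} {K : SimpleGraph U} (e : G ≃g H) (h : K.IsMinorOf G) :
    K.IsMinorOf H := by
  obtain ⟨B, hconn, hdisj, hadj⟩ := h
  refine ⟨fun x => e '' B x, fun x => ?_, fun x y hxy => ?_, fun x y hxy => ?_⟩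
  · let f : G.induce (B x) →g H.induce (e '' B x) :=
      ⟨fun a => ⟨e a, Set.mem_image_of_mem _ a.2⟩, fun {a b} hab => e.map_adj_iff.2 hab⟩
    refine (hconn x).map f ?_
    rintro ⟨_, a, ha, rfl⟩
    exact ⟨⟨a, ha⟩, rfl⟩
  · exact (Set.disjoint_image_iff e.injective).2 (hdisj x y hxy)
  · obtain ⟨a, ha, b, hb, hab⟩ := hadj x y hxy
    exact ⟨e a, Set.mem_image_of_mem _ ha, e b, Set.mem_image_of_mem _ hb, e.map_adj_iff.2 hab⟩

end SimpleGraph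

theorem theorem1 :
    SimpleGraph.IsTypicalPiGraph.{0, v} fareyGraph ∧
      ∀ (V : Type u) (G : SimpleGraph V),
        SimpleGraph.IsTypicalPiGraph.{u, v} G → G.MinorEquivalent fareyGraph := by
  refine ⟨⟨fareyGraph_isPiGraph, fun W H hH => hH.fareyGraph_isMinorOf⟩, fun V G hG =>
    ⟨?_, hG.1.fareyGraph_isMinorOf⟩⟩
  -- Typicality of `G` concerns graphs in universe `v`, so the Farey graph is lifted there.
  have e : fareyGraph.comap (Equiv.ulift.{v} : ULift (OnePoint ℚ) ≃ OnePoint ℚ) ≃g fareyGraph :=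
    SimpleGraph.Iso.comap _ _
  exact (hG.2 _ _ (fareyGraph_isPiGraph.of_iso e.symm)).of_iso e
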